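/- Fix $d\ge 2$, $c_1,\dots,c_K\in\mathbb R$ and $t\in\mathbb R$, and put $c:=\sum_{j=1}^K|c_j|$. For density matrices $\rho=(\rho_1,\dots,\rho_K)$ on $\mathbb C^d$ let $H_\rho:=\sum_{j=1}^K c_j\rho_j$. A protocol using $n$ copies is a sequence of quantum channels (completely positive trace-preserving maps), not depending on $\rho$, that encodes an input state $\sigma$ on $\mathbb C^d$ into a workspace of arbitrary finite dimension, then performs $n$ rounds, in each of which it chooses a label $j\in\{1,\dots,K\}$ (possibly at random and depending on everything that happened before), receives one fresh copy of $\rho_j$ and applies an arbitrary channel to this copy and the workspace, and finally outputs a state $\mathcal E_\rho(\sigma)$ on $\mathbb C^d$. It simulates $H_\rho$ for time $t$ to error $\delta$ in trace norm if $$\tfrac12\bigl\|\mathcal E_\rho(\sigma)-e^{-iH_\rho t}\,\sigma\, e^{iH_\rho t}\bigr\|_1\le\delta\quad\text{for every density matrix }\sigma \text{ on } \mathbb C^d,$$ where $\|A\|_1=\operatorname{Tr}\sqrt{AA^\dagger}$. **Theorem (optimality for linear combinations).** There are absolute constants $C,\delta_0,\kappa_0>0$ such that the following holds for all $K$, all $c_1,\dots,c_K\in\mathbb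 R$, all $d\ge2$, all $t\in\mathbb R$ and all $\delta>0$ with $c|t|>0$, $\delta\le\delta_0$ and $\delta/(c|t|)\le\kappa_0$. There exist two $K$-tuples of density matrices on $\mathbb C^d$ such that every protocol that is not told which of the two tuples $\rho$ its copies are drawn from, i.e. every protocol that simulates $H_\rho$ for time $t$ to error $\delta$ in trace norm for both of these tuples $\rho$, uses in total $$n\ \ge\ C\,\frac{c^2t^2}{\delta}$$ copies of the states $\rho_1,\dots,\rho_K$. In particular, simulating $H=\sum_j c_j\rho_j$ for unknown states $\rho_1,\dots,\rho_K$ requires $\Omega(c^2t^2/\delta)$ copies. -/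

import Mathlib

open scoped Matrix ComplexOrder

noncomputable section

namespace SampleSim

/-- The trace norm `‖A‖₁ = Tr √(A A†)` of a square complex matrix. -/
def traceNorm {a : Type*} [Fintype a] [DecidableEq a] (A : Matrix a a ℂ) : ℝ :=
  (Matrix.trace (cfc Real.sqrt (A * Aᴴ))).re

/-- Quantum states (density matrices): positive semidefinite of trace one. -/
def IsState {a : Type*} [Fintype a] (ρ : Matrix a a ℂ) : Prop :=
  ρ.PosSemidef ∧ ρ.trace = 1

/-- The map `Φ ⊗ id` on operators on `ℂ^a ⊗ ℂ^k`: `Φ` is applied to every block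
`(⟨p| on the second factor) X (|q⟩ on the second factor)`. -/
def tensorId {a b : Type*} (k : Type*)
    (Φ : Matrix a a ℂ →ₗ[ℂ] Matrix b b ℂ) :
    Matrix (a × k) (a × k) ℂ →ₗ[ℂ] Matrix (b × k) (b × k) ℂ where
  toFun X := Matrix.of fun x y => Φ (Matrix.of fun i j => X (i, x.2) (j, y.2)) x.1 y.1
  map_add' X Y := by
    ext x y
    exact congrFun (congrFun (Φ.map_add (Matrix.of fun i j => X (i, x.2) (j, y.2))
      (Matrix.of fun i j => Y (i, x.2) (j, y.2))) x.1) y.1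
  map_smul' r X := by
    ext x y
    exact congrFun (congrFun (Φ.map_smul r (Matrix.of fun i j => X (i, x.2) (j, y.2))) x.1) y.1

/-- Quantum channels from operators on `ℂ^a` to operators on `ℂ^b`: completely positive
trace-preserving linear maps. -/
structure Channel (a b : Type*) [Fintype a] [Fintype b] where
  map : Matrix a a ℂ →ₗ[ℂ] Matrix b b ℂ
  completelyPositive : ∀ (k : ℕ) (X : Matrix (a × Fin k) (a × Fin k) ℂ),
    X.PosSemidef → (tensorId (Fin k) map X).PosSemidef
  tracePreserving : ∀ X : Matrix a a ℂ, (map X).trace = X.trace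

/-- Drawing one copy from the collection `ρ₁, …, ρ_K`: the label register is read in the
computational basis, and if the label is `j`, one fresh copy of `ρ j` is delivered. -/
def drawCopy {K d : ℕ} (ρ : Fin K → Matrix (Fin d) (Fin d) ℂ) :
    Matrix (Fin K) (Fin K) ℂ →ₗ[ℂ] Matrix (Fin d) (Fin d) ℂ where
  toFun X := ∑ j, X j j • ρ j
  map_add' X Y := by simp [add_smul, Finset.sum_add_distrib]
  map_smul' r X := by simp [Finset.smul_sum, smul_smul]

/-- A protocol on a `d`-dimensional system that consumes `n` copies in total of states from an
unknown collection `ρ₁, …, ρ_K` of states of dimension `d`. The input is encoded into a workspace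
of arbitrary finite dimension; then `n` rounds follow, in each of which an arbitrary channel
prepares a label register (so that the choice of the state to be drawn may be random and may
depend on everything that happened before), one copy of the state with that label is drawn, and an
arbitrary channel absorbs the copy into the workspace; at the end the output is decoded.
The channels do not depend on `ρ₁, …, ρ_K`. Copies may be kept in the workspace, so joint
operations on all `n` copies are included. -/
structure Protocol (d K n : ℕ) where
  dimW : ℕ
  encode : Channel (Fin d) (Fin dimW)
  label : Fin n → Channel (Fin dimW) (Fin K × Fin dimW)
  absorb : Fin n → Channel (Fin d × Fin dimW) (Fin dimW)
  decode : Channel (Fin dimW) (Fin d)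

namespace Protocol

variable {d K n : ℕ}

/-- The state of the workspace after `i` rounds, on input `σ`. -/
def workspace (P : Protocol d K n) (ρ : Fin K → Matrix (Fin d) (Fin d) ℂ)
    (σ : Matrix (Fin d) (Fin d) ℂ) :
    (i : ℕ) → i ≤ n → Matrix (Fin P.dimW) (Fin P.dimW) ℂ
  | 0, _ => P.encode.map σ
  | i + 1, h =>
    (P.absorb ⟨i, h⟩).map
      (tensorId (Fin P.dimW) (drawCopy ρ)
        ((P.label ⟨i, h⟩).map (P.workspace ρ σ i (Nat.le_of_succ_le h))))

/-- The output of the protocol on input `σ`, when it draws its `n` copies from `ρ₁, …, ρ_K`. -/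
def output (P : Protocol d K n) (ρ : Fin K → Matrix (Fin d) (Fin d) ℂ)
    (σ : Matrix (Fin d) (Fin d) ℂ) : Matrix (Fin d) (Fin d) ℂ :=
  P.decode.map (P.workspace ρ σ n le_rfl)

end Protocol

/-- The Hamiltonian `H = ∑ⱼ cⱼ ρⱼ`. -/
def hamiltonian {K d : ℕ} (c : Fin K → ℝ) (ρ : Fin K → Matrix (Fin d) (Fin d) ℂ) :
    Matrix (Fin d) (Fin d) ℂ :=
  ∑ j, (c j : ℂ) • ρ j

/-- The ideal evolution `σ ↦ e^{-iHt} σ e^{iHt}`. -/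
def evolve {d : ℕ} (H : Matrix (Fin d) (Fin d) ℂ) (t : ℝ) (σ : Matrix (Fin d) (Fin d) ℂ) :
    Matrix (Fin d) (Fin d) ℂ :=
  NormedSpace.exp ((-(Complex.I * t)) • H) * σ * NormedSpace.exp ((Complex.I * t) • H)

/-- When it draws its copies from `ρ₁, …, ρ_K`, the protocol simulates `H = ∑ⱼ cⱼ ρⱼ` for time `t`
with error at most `δ` in trace norm distance: `½ ‖𝓔(σ) - e^{-iHt} σ e^{iHt}‖₁ ≤ δ` for every
input state `σ`. -/
def Simulates {d K n : ℕ} (P : Protocol d K n) (c : Fin K → ℝ)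
    (ρ : Fin K → Matrix (Fin d) (Fin d) ℂ) (t δ : ℝ) : Prop :=
  ∀ σ : Matrix (Fin d) (Fin d) ℂ, IsState σ →
    1 / 2 * traceNorm (P.output ρ σ - evolve (hamiltonian c ρ) t σ) ≤ δ

end SampleSim

end

open scoped Kronecker

namespace SampleSim

/-! Take diagonal states with spectra (1/2 ± x, 1/2 ∓ x, 0, …, 0), the signs following those of the
c_j, so that their contributions to the gap of H between the first two levels add up to 2xS, where S
= ∑ |c_j|. Repeating the simulation m ≈ 1/(8δ) times keeps the error below a constant
(`Simulates.abs_expectation_iterate_sub_le`), while for x = π/(4Stm) the phase accumulates to ±π/2: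
the plus state is sent to orthogonal states for x and -x (`expectation_evolve_plusState`). So mn
copies tell the two tuples apart.

On the other hand, each copy is determined by its label and one bit of bias x, so the repeated
output depends on x only through mn such bits (`IsBitMixture.iterate_output`), and telling bias x
from -x takes Ω(1/x²) bits (`one_le_mul_sq_of_advantage`). Hence mn ≳ 1/x² ≈ (Stm)², that is, n ≳
S²t²m ≈ S²t²/δ. -/

/-- The real part of the quadratic form `v† X v`. -/
noncomputable def expectation {a : Type*} [Fintype a] (v : a → ℂ) (X : Matrix a a ℂ) : ℝ :=
  (star v ⬝ᵥ X *ᵥ v).re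

/-! ### Quadratic forms, trace norm and states -/

section Expectation

variable {a : Type*} [Fintype a]

lemma expectation_add (v : a → ℂ) (X Y : Matrix a a ℂ) :
    expectation v (X + Y) = expectation v X + expectation v Y := by
  simp [expectation, Matrix.add_mulVec]

lemma expectation_sub (v : a → ℂ) (X Y : Matrix a a ℂ) :
    expectation v (X - Y) = expectation v X - expectation v Y := by
  simp [expectation, Matrix.sub_mulVec]

lemma expectation_smul (v : a → ℂ) (r : ℝ) (X : Matrix a a ℂ) :
    expectation v ((r : ℂ) • X) = r * expectation v X := by
  simp [expectation, Matrix.smul_mulVec]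

lemma expectation_sum (v : a → ℂ) {ι : Type*} (s : Finset ι) (X : ι → Matrix a a ℂ) :
    expectation v (∑ i ∈ s, X i) = ∑ i ∈ s, expectation v (X i) := by
  simp [expectation, Matrix.sum_mulVec, dotProduct_sum]

lemma expectation_conj (v : a → ℂ) (U X : Matrix a a ℂ) :
    expectation v (U * X * Uᴴ) = expectation (Uᴴ *ᵥ v) X := by
  simp only [expectation, Matrix.star_mulVec, Matrix.conjTranspose_conjTranspose,
    ← Matrix.mulVec_mulVec, Matrix.dotProduct_mulVec, Matrix.vecMul_vecMul]

variable [DecidableEq a]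

lemma exists_unitary_diagonal {A : Matrix a a ℂ} (hA : A.IsHermitian) :
    ∃ (U : Matrix a a ℂ) (l : a → ℝ), Uᴴ * U = 1 ∧ U * Uᴴ = 1 ∧
      ∀ f : ℝ → ℝ, cfc f A = U * Matrix.diagonal (fun i => ((f (l i) : ℝ) : ℂ)) * Uᴴ := by
  refine ⟨hA.eigenvectorUnitary, hA.eigenvalues, ?_, ?_, fun f => ?_⟩
  · rw [← Matrix.star_eq_conjTranspose]; exact Unitary.coe_star_mul_self _
  · rw [← Matrix.star_eq_conjTranspose]; exact Unitary.coe_mul_star_self _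
  · rw [hA.cfc_eq, Matrix.IsHermitian.cfc, Unitary.conjStarAlgAut_apply]
    rfl

lemma expectation_diagonal (w : a → ℂ) (l : a → ℝ) :
    expectation w (Matrix.diagonal fun i => (l i : ℂ)) = ∑ i, l i * Complex.normSq (w i) := by
  simp only [expectation, dotProduct, Matrix.mulVec_diagonal, Complex.re_sum]
  refine Finset.sum_congr rfl fun i _ => ?_
  simp [Complex.normSq_apply]
  ring

lemma normSq_le_expectation_one (w : a → ℂ) (i : a) :
    Complex.normSq (w i) ≤ expectation w 1 := by
  have h := expectation_diagonal w (fun _ => 1)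
  simp only [Complex.ofReal_one, Matrix.diagonal_one, one_mul] at h
  rw [h]
  exact Finset.single_le_sum (fun j _ => Complex.normSq_nonneg (w j)) (Finset.mem_univ i)

lemma expectation_conj_one {U : Matrix a a ℂ} (hU : U * Uᴴ = 1) (v : a → ℂ) :
    expectation (Uᴴ *ᵥ v) 1 = expectation v 1 := by
  rw [← expectation_conj, mul_one, hU]

lemma abs_expectation_diagonal_le (w : a → ℂ) (l : a → ℝ) :
    |expectation w (Matrix.diagonal fun i => (l i : ℂ))| ≤ expectation w 1 * ∑ i, |l i| := by
  rw [expectation_diagonal, Finset.mul_sum]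
  refine (Finset.abs_sum_le_sum_abs _ _).trans (Finset.sum_le_sum fun i _ => ?_)
  rw [abs_mul, abs_of_nonneg (Complex.normSq_nonneg _), mul_comm]
  exact mul_le_mul_of_nonneg_right (normSq_le_expectation_one w i) (abs_nonneg _)

lemma traceNorm_eq_sum_abs {A U : Matrix a a ℂ} {l : a → ℝ} (hA : A.IsHermitian)
    (hU : Uᴴ * U = 1)
    (h : ∀ f : ℝ → ℝ, cfc f A = U * Matrix.diagonal (fun i => ((f (l i) : ℝ) : ℂ)) * Uᴴ) :
    traceNorm A = ∑ i, |l i| := by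
  have hs : IsSelfAdjoint A := hA
  have hsq : A * Aᴴ = cfc (fun x : ℝ => x ^ 2) A := by
    rw [cfc_pow_id A 2, hA.eq, pow_two]
  have hc : cfc Real.sqrt (A * Aᴴ) = cfc (fun x : ℝ => |x|) A := by
    rw [hsq, ← cfc_comp' Real.sqrt (fun x : ℝ => x ^ 2) A]
    simp only [Real.sqrt_sq_eq_abs]
  rw [traceNorm, hc, h, Matrix.trace_mul_cycle, hU, one_mul]
  simp [Matrix.trace]

lemma abs_expectation_le_traceNorm {A : Matrix a a ℂ} (hA : A.IsHermitian) (v : a → ℂ) :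
    |expectation v A| ≤ expectation v 1 * traceNorm A := by
  obtain ⟨U, l, hU, hU', h⟩ := exists_unitary_diagonal hA
  have hs : IsSelfAdjoint A := hA
  have hA' : A = U * Matrix.diagonal (fun i => (l i : ℂ)) * Uᴴ := by
    rw [← h fun x => x, cfc_id' ℝ A]
  rw [traceNorm_eq_sum_abs hA hU h]
  conv_lhs => rw [hA', expectation_conj]
  rw [← expectation_conj_one hU']
  exact abs_expectation_diagonal_le _ _

lemma IsState.abs_expectation_le {X : Matrix a a ℂ} (hX : IsState X) (v : a → ℂ) :
    |expectation v X| ≤ expectation v 1 := by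
  obtain ⟨U, l, hU, hU', h⟩ := exists_unitary_diagonal hX.1.isHermitian
  have hs : IsSelfAdjoint X := hX.1.isHermitian
  have hX' : X = U * Matrix.diagonal (fun i => (l i : ℂ)) * Uᴴ := by
    rw [← h fun x => x, cfc_id' ℝ X]
  have hl : ∀ i, 0 ≤ l i := by
    have := hX.1.conjTranspose_mul_mul_same U
    rw [hX', ← mul_assoc, ← mul_assoc, hU, one_mul, mul_assoc, hU, mul_one,
      Matrix.posSemidef_diagonal_iff] at this
    exact fun i => by simpa using this i
  have ht : ∑ i, |l i| = 1 := by
    have := hX.2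
    rw [hX', Matrix.trace_mul_cycle, hU, one_mul, Matrix.trace_diagonal] at this
    simp only [abs_of_nonneg (hl _)]
    exact_mod_cast this
  conv_lhs => rw [hX', expectation_conj]
  rw [← expectation_conj_one hU', ← mul_one (expectation _ 1), ← ht]
  exact abs_expectation_diagonal_le _ _

end Expectation

/-! ### Distinguishing biased bits -/

/-- The weight `∏ᵢ (1/2 ± x)` of a string of biased bits. -/
noncomputable def bitWeight {N : ℕ} (x : ℝ) (s : Fin N → Bool) : ℝ :=
  ∏ i, (1 / 2 + if s i then x else -x)

lemma sum_prod_bit (N : ℕ) (f : Bool → ℝ) :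
    ∑ s : Fin N → Bool, ∏ i, f (s i) = (f true + f false) ^ N := by
  have h := Finset.prod_univ_sum (fun _ : Fin N => (Finset.univ : Finset Bool)) fun _ b => f b
  simp only [Fintype.piFinset_univ] at h
  rw [← h]
  simp

lemma sum_bitWeight_mul (N : ℕ) (x y : ℝ) :
    ∑ s : Fin N → Bool, bitWeight x s * bitWeight y s = (1 / 2 + 2 * (x * y)) ^ N := by
  have h := sum_prod_bit N fun b =>
    (1 / 2 + if b then x else -x) * (1 / 2 + if b then y else -y)
  simp only [bitWeight, ← Finset.prod_mul_distrib]
  rw [h]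
  congr 1
  simp
  ring

/-- Cauchy–Schwarz over all bit strings; the squared distance of the weights is explicit because
their inner products factor over the bits. -/
lemma sq_sum_bitWeight_sub_le (N : ℕ) (x r : ℝ) (g : (Fin N → Bool) → ℝ) (hg : ∀ s, |g s| ≤ r) :
    (∑ s, (bitWeight x s - bitWeight (-x) s) * g s) ^ 2 ≤
      2 * ((1 + 4 * x ^ 2) ^ N - (1 - 4 * x ^ 2) ^ N) * r ^ 2 := by
  have h1 : ∑ s : Fin N → Bool, (bitWeight x s - bitWeight (-x) s) ^ 2 =
      2 * ((1 / 2 + 2 * x ^ 2) ^ N - (1 / 2 - 2 * x ^ 2) ^ N) := by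
    have e : ∀ s : Fin N → Bool, (bitWeight x s - bitWeight (-x) s) ^ 2 =
        bitWeight x s * bitWeight x s + bitWeight (-x) s * bitWeight (-x) s
          - 2 * (bitWeight x s * bitWeight (-x) s) := fun s => by ring
    simp only [e, Finset.sum_sub_distrib, Finset.sum_add_distrib, ← Finset.mul_sum,
      sum_bitWeight_mul]
    ring_nf
  have h2 : ∑ s : Fin N → Bool, g s ^ 2 ≤ 2 ^ N * r ^ 2 := by
    calc ∑ s, g s ^ 2 ≤ ∑ _s : Fin N → Bool, r ^ 2 :=
          Finset.sum_le_sum fun s _ => sq_le_sq' (abs_le.1 (hg s)).1 (abs_le.1 (hg s)).2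
      _ = 2 ^ N * r ^ 2 := by simp
  have h3 : (1 + 4 * x ^ 2) ^ N = (1 / 2 + 2 * x ^ 2) ^ N * 2 ^ N := by
    rw [← mul_pow]; ring_nf
  have h4 : (1 - 4 * x ^ 2) ^ N = (1 / 2 - 2 * x ^ 2) ^ N * 2 ^ N := by
    rw [← mul_pow]; ring_nf
  calc _ ≤ (∑ s, (bitWeight x s - bitWeight (-x) s) ^ 2) * ∑ s, g s ^ 2 :=
        Finset.sum_mul_sq_le_sq_mul_sq _ _ _
    _ ≤ (∑ s, (bitWeight x s - bitWeight (-x) s) ^ 2) * (2 ^ N * r ^ 2) :=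
        mul_le_mul_of_nonneg_left h2 (Finset.sum_nonneg fun _ _ => sq_nonneg _)
    _ = _ := by rw [h1, h3, h4]; ring

/-- Distinguishing bias `x` from bias `-x` with constant advantage takes `Ω(1/x²)` bits. -/
lemma one_le_mul_sq_of_advantage {N : ℕ} {x : ℝ}
    (h : 1 / 4 ≤ 2 * ((1 + 4 * x ^ 2) ^ N - (1 - 4 * x ^ 2) ^ N)) (hx : |x| ≤ 1 / 2) :
    1 ≤ 96 * N * x ^ 2 := by
  have hx2 : x ^ 2 ≤ 1 / 4 := by
    rw [← sq_abs]; nlinarith [abs_nonneg x]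
  by_contra! hlt
  -- If y < 1/24, the two powers differ by at most 3y < 1/8, which contradicts the assumed
  -- advantage; 96 = 4 · 24.
  set y : ℝ := N * (4 * x ^ 2) with hy
  have hy0 : 0 ≤ y := by positivity
  have hy1 : y < 1 / 24 := by rw [hy]; linarith
  have h1 : (1 + 4 * x ^ 2) ^ N ≤ 1 + 2 * y := by
    calc (1 + 4 * x ^ 2) ^ N ≤ Real.exp (4 * x ^ 2) ^ N := by
          gcongr
          linarith [Real.add_one_le_exp (4 * x ^ 2)]
      _ = Real.exp y := by rw [← Real.exp_nat_mul]
      _ ≤ 1 / (1 - y) := Real.exp_bound_div_one_sub_of_interval hy0 (by linarith)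
      _ ≤ 1 + 2 * y := by
          rw [div_le_iff₀ (by linarith)]
          nlinarith
  have h2 : 1 - y ≤ (1 - 4 * x ^ 2) ^ N := by
    have := one_add_mul_le_pow (show -2 ≤ -(4 * x ^ 2) by linarith) N
    have e : 1 - y = 1 + N * -(4 * x ^ 2) := by rw [hy]; ring
    rwa [e, sub_eq_add_neg]
  linarith

/-! ### Protocols preserve states -/

lemma IsState.channel {a b : Type*} [Fintype a] [Fintype b] (Φ : Channel a b)
    {X : Matrix a a ℂ} (hX : IsState X) : IsState (Φ.map X) := by
  refine ⟨?_, by rw [Φ.tracePreserving, hX.2]⟩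
  -- Positivity is complete positivity with a one-dimensional ancilla.
  have h := (Φ.completelyPositive 1 _ (hX.1.submatrix (Prod.fst : a × Fin 1 → a))).submatrix
    (fun i : b => (i, (0 : Fin 1)))
  exact h

lemma tensorId_drawCopy {K d : ℕ} {k : Type*} (ρ : Fin K → Matrix (Fin d) (Fin d) ℂ)
    (X : Matrix (Fin K × k) (Fin K × k) ℂ) :
    tensorId k (drawCopy ρ) X =
      ∑ j, ρ j ⊗ₖ X.submatrix (fun q => (j, q)) (fun q => (j, q)) := by
  ext x y
  simp [tensorId, drawCopy, Matrix.sum_apply, Matrix.kroneckerMap_apply, mul_comm]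

lemma IsState.tensorId_drawCopy {K d : ℕ} {k : Type*} [Fintype k] [DecidableEq k]
    {ρ : Fin K → Matrix (Fin d) (Fin d) ℂ} (hρ : ∀ j, IsState (ρ j))
    {X : Matrix (Fin K × k) (Fin K × k) ℂ} (hX : IsState X) :
    IsState (tensorId k (drawCopy ρ) X) := by
  rw [SampleSim.tensorId_drawCopy]
  refine ⟨Matrix.posSemidef_sum _ fun j _ => (hρ j).1.kronecker (hX.1.submatrix _), ?_⟩
  rw [Matrix.trace_sum, ← hX.2]
  simp only [Matrix.trace_kronecker, (hρ _).2, one_mul]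
  simp [Matrix.trace, Fintype.sum_prod_type]

lemma Protocol.isState_workspace {d K n : ℕ} (P : Protocol d K n)
    {ρ : Fin K → Matrix (Fin d) (Fin d) ℂ} (hρ : ∀ j, IsState (ρ j))
    {σ : Matrix (Fin d) (Fin d) ℂ} (hσ : IsState σ) :
    ∀ (i : ℕ) (h : i ≤ n), IsState (P.workspace ρ σ i h)
  | 0, _ => hσ.channel P.encode
  | i + 1, h =>
    (((P.isState_workspace hρ hσ i (Nat.le_of_succ_le h)).channel
      (P.label ⟨i, h⟩)).tensorId_drawCopy hρ).channel (P.absorb ⟨i, h⟩)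

lemma Protocol.isState_output {d K n : ℕ} (P : Protocol d K n)
    {ρ : Fin K → Matrix (Fin d) (Fin d) ℂ} (hρ : ∀ j, IsState (ρ j))
    {σ : Matrix (Fin d) (Fin d) ℂ} (hσ : IsState σ) : IsState (P.output ρ σ) :=
  (P.isState_workspace hρ hσ n le_rfl).channel P.decode

/-! ### Reduction of copies to biased bits -/

/-- The family `G x` arises from `N` bits of bias `x`, by preparing a state that depends on them
but not on `x`. -/
def IsBitMixture {a : Type*} [Fintype a] (N : ℕ) (G : ℝ → Matrix a a ℂ) : Prop :=
  ∃ Y : (Fin N → Bool) → Matrix a a ℂ, (∀ s, IsState (Y s)) ∧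
    ∀ x, G x = ∑ s, (bitWeight x s : ℂ) • Y s

namespace IsBitMixture

variable {a b : Type*} [Fintype a] [Fintype b] {N : ℕ} {G : ℝ → Matrix a a ℂ}

lemma const {X : Matrix a a ℂ} (hX : IsState X) : IsBitMixture 0 fun _ => X :=
  ⟨fun _ => X, fun _ => hX, fun x => by simp [bitWeight]⟩

lemma channel (hG : IsBitMixture N G) (Φ : Channel a b) :
    IsBitMixture N fun x => Φ.map (G x) := by
  obtain ⟨Y, hY, h⟩ := hG
  exact ⟨fun s => Φ.map (Y s), fun s => (hY s).channel Φ, fun x => by simp [h]⟩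

/-- A draw is linear in the tuple, so one fresh bit can choose between `τ true` and `τ false`
whatever the label is: adaptive or random labels cost no extra bits. -/
lemma tensorId_drawCopy {K d : ℕ} {k : Type*} [Fintype k] [DecidableEq k]
    {G : ℝ → Matrix (Fin K × k) (Fin K × k) ℂ} (hG : IsBitMixture N G)
    {ρ : ℝ → Fin K → Matrix (Fin d) (Fin d) ℂ} {τ : Bool → Fin K → Matrix (Fin d) (Fin d) ℂ}
    (hτ : ∀ b j, IsState (τ b j))
    (hρ : ∀ x j, ρ x j = ((1 / 2 + x : ℝ) : ℂ) • τ true j + ((1 / 2 + -x : ℝ) : ℂ) • τ false j) :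
    IsBitMixture (N + 1) fun x => tensorId k (drawCopy (ρ x)) (G x) := by
  obtain ⟨Y, hY, h⟩ := hG
  refine ⟨fun s => tensorId k (drawCopy (τ (s 0))) (Y fun i => s i.succ),
    fun s => (hY _).tensorId_drawCopy (hτ _), fun x => ?_⟩
  have hlin : ∀ X : Matrix (Fin K × k) (Fin K × k) ℂ, tensorId k (drawCopy (ρ x)) X =
      ((1 / 2 + x : ℝ) : ℂ) • tensorId k (drawCopy (τ true)) X +
        ((1 / 2 + -x : ℝ) : ℂ) • tensorId k (drawCopy (τ false)) X := fun X => by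
    simp only [SampleSim.tensorId_drawCopy, hρ, Matrix.add_kronecker, Matrix.smul_kronecker,
      Finset.sum_add_distrib, Finset.smul_sum]
  rw [← (Fin.consEquiv fun _ => Bool).sum_comp, Fintype.sum_prod_type]
  have hcons : ∀ (b : Bool) (s : Fin N → Bool),
      (Fin.consEquiv fun _ => Bool) (b, s) = (Fin.cons b s : Fin (N + 1) → Bool) := fun _ _ => rfl
  have hw : ∀ (b : Bool) (s : Fin N → Bool), bitWeight x (Fin.cons b s : Fin (N + 1) → Bool) =
      (1 / 2 + if b then x else -x) * bitWeight x s := fun b s => by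
    simp [bitWeight, Fin.prod_univ_succ]
  beta_reduce
  rw [hlin, h]
  simp only [map_sum, map_smul, Fintype.sum_bool, hcons, hw, Fin.cons_zero, Fin.cons_succ,
    Finset.smul_sum, smul_smul, Complex.ofReal_mul]
  rfl

lemma abs_expectation_sub_sq_le (hG : IsBitMixture N G) [DecidableEq a] (v : a → ℂ) (x : ℝ) :
    (expectation v (G x) - expectation v (G (-x))) ^ 2 ≤
      2 * ((1 + 4 * x ^ 2) ^ N - (1 - 4 * x ^ 2) ^ N) * expectation v 1 ^ 2 := by
  obtain ⟨Y, hY, h⟩ := hG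
  simp only [h, expectation_sum, expectation_smul, ← Finset.sum_sub_distrib, ← sub_mul]
  exact sq_sum_bitWeight_sub_le N x _ _ fun s => (hY s).abs_expectation_le v

variable {d K n : ℕ} {ρ : ℝ → Fin K → Matrix (Fin d) (Fin d) ℂ}
  {τ : Bool → Fin K → Matrix (Fin d) (Fin d) ℂ}

/-- The input may itself depend on earlier bits, so that outputs can be fed back into the protocol.
-/
lemma workspace (P : Protocol d K n) {σ : ℝ → Matrix (Fin d) (Fin d) ℂ} (hσ : IsBitMixture N σ)
    (hτ : ∀ b j, IsState (τ b j))
    (hρ : ∀ x j, ρ x j = ((1 / 2 + x : ℝ) : ℂ) • τ true j + ((1 / 2 + -x : ℝ) : ℂ) • τ false j) :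
    ∀ (i : ℕ) (h : i ≤ n), IsBitMixture (N + i) fun x => P.workspace (ρ x) (σ x) i h
  | 0, _ => hσ.channel P.encode
  | i + 1, h =>
    (((workspace P hσ hτ hρ i (Nat.le_of_succ_le h)).channel
      (P.label ⟨i, h⟩)).tensorId_drawCopy hτ hρ).channel (P.absorb ⟨i, h⟩)

lemma iterate_output (P : Protocol d K n) {σ : Matrix (Fin d) (Fin d) ℂ} (hσ : IsState σ)
    (hτ : ∀ b j, IsState (τ b j))
    (hρ : ∀ x j, ρ x j = ((1 / 2 + x : ℝ) : ℂ) • τ true j + ((1 / 2 + -x : ℝ) : ℂ) • τ false j)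
    (m : ℕ) : IsBitMixture (m * n) fun x => (P.output (ρ x))^[m] σ := by
  induction m with
  | zero => rw [zero_mul]; exact const hσ
  | succ m ih =>
    simp only [Function.iterate_succ_apply', Nat.succ_mul]
    exact (workspace P ih hτ hρ n le_rfl).channel P.decode

end IsBitMixture

/-! ### Diagonal evolution and error accumulation -/

section Evolution

variable {d : ℕ}

/-- The unitary `e^{-iHt}` for `H` diagonal with entries `h`. -/
noncomputable def diagonalPhase (h : Fin d → ℝ) (t : ℝ) : Matrix (Fin d) (Fin d) ℂ :=
  Matrix.diagonal fun k => Complex.exp (-(Complex.I * t) * h k)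

lemma diagonalPhase_conjTranspose (h : Fin d → ℝ) (t : ℝ) :
    (diagonalPhase h t)ᴴ = Matrix.diagonal fun k => Complex.exp ((Complex.I * t) * h k) := by
  rw [diagonalPhase, Matrix.diagonal_conjTranspose]
  congr 1
  ext k
  simp [← Complex.exp_conj]

lemma diagonalPhase_mul_conjTranspose (h : Fin d → ℝ) (t : ℝ) :
    diagonalPhase h t * (diagonalPhase h t)ᴴ = 1 := by
  rw [diagonalPhase_conjTranspose, diagonalPhase, Matrix.diagonal_mul_diagonal]
  simp [← Complex.exp_add]

lemma evolve_diagonal (h : Fin d → ℝ) (t : ℝ) (X : Matrix (Fin d) (Fin d) ℂ) :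
    evolve (Matrix.diagonal fun k => (h k : ℂ)) t X =
      diagonalPhase h t * X * (diagonalPhase h t)ᴴ := by
  rw [evolve, ← Matrix.diagonal_smul, ← Matrix.diagonal_smul, Matrix.exp_diagonal,
    Matrix.exp_diagonal, diagonalPhase_conjTranspose, diagonalPhase]
  simp only [Pi.exp_def, Complex.exp_eq_exp_ℂ]
  rfl

lemma evolve_diagonal_iterate_apply (h : Fin d → ℝ) (t : ℝ) (X : Matrix (Fin d) (Fin d) ℂ)
    (m : ℕ) (k l : Fin d) :
    (evolve (Matrix.diagonal fun k => (h k : ℂ)) t)^[m] X k l =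
      Complex.exp ((m * t * (h l - h k) : ℝ) * Complex.I) * X k l := by
  induction m with
  | zero => simp
  | succ m ih =>
    rw [Function.iterate_succ_apply', evolve_diagonal, diagonalPhase_conjTranspose, diagonalPhase,
      Matrix.mul_diagonal, Matrix.diagonal_mul, ih]
    rw [mul_right_comm, ← mul_assoc, ← Complex.exp_add, ← Complex.exp_add]
    congr 2
    push_cast
    ring

lemma IsState.evolve_diagonal {X : Matrix (Fin d) (Fin d) ℂ} (hX : IsState X) (h : Fin d → ℝ)
    (t : ℝ) : IsState (evolve (Matrix.diagonal fun k => (h k : ℂ)) t X) := by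
  rw [SampleSim.evolve_diagonal]
  refine ⟨hX.1.mul_mul_conjTranspose_same _, ?_⟩
  rw [Matrix.trace_mul_comm, ← mul_assoc, mul_eq_one_comm.1
    (diagonalPhase_mul_conjTranspose h t), one_mul, hX.2]

/-- The error of an `m`-fold repetition of a simulation is at most `m` times its error. -/
lemma Simulates.abs_expectation_iterate_sub_le {K n : ℕ} {P : Protocol d K n} {c : Fin K → ℝ}
    {ρ : Fin K → Matrix (Fin d) (Fin d) ℂ} {t δ : ℝ} (hP : Simulates P c ρ t δ)
    (hρ : ∀ j, IsState (ρ j)) {h : Fin d → ℝ}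
    (hH : hamiltonian c ρ = Matrix.diagonal fun k => (h k : ℂ))
    {σ : Matrix (Fin d) (Fin d) ℂ} (hσ : IsState σ) (m : ℕ) (v : Fin d → ℂ) :
    |expectation v ((P.output ρ)^[m] σ - (evolve (hamiltonian c ρ) t)^[m] σ)| ≤
      expectation v 1 * (2 * m * δ) := by
  induction m generalizing v with
  | zero => simp [expectation]
  | succ m ih =>
    have hstate : IsState ((P.output ρ)^[m] σ) :=
      Function.Iterate.rec IsState hσ (fun _ hX => P.isState_output hρ hX) m
    simp only [Function.iterate_succ_apply']
    set X := (P.output ρ)^[m] σ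
    set Z := (evolve (hamiltonian c ρ) t)^[m] σ
    -- The simulation guarantee is applied at the actual state X. The inherited error X - Z is
    -- conjugated by a unitary, which passes to the test vector and preserves its norm; hence the
    -- induction over all `v`.
    have hsplit : P.output ρ X - evolve (hamiltonian c ρ) t Z =
        (P.output ρ X - evolve (hamiltonian c ρ) t X) +
          diagonalPhase h t * (X - Z) * (diagonalPhase h t)ᴴ := by
      rw [hH, evolve_diagonal, evolve_diagonal, mul_sub, sub_mul]
      abel
    have hherm : (P.output ρ X - evolve (hamiltonian c ρ) t X).IsHermitian := by
      rw [hH]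
      exact (P.isState_output hρ hstate).1.isHermitian.sub
        (hstate.evolve_diagonal h t).1.isHermitian
    have h1 := abs_expectation_le_traceNorm hherm v
    have h2 := ih ((diagonalPhase h t)ᴴ *ᵥ v)
    rw [expectation_conj_one (diagonalPhase_mul_conjTranspose h t)] at h2
    have h3 := hP X hstate
    have h0 : 0 ≤ expectation v 1 := (abs_nonneg _).trans (hstate.abs_expectation_le v)
    rw [hsplit, expectation_add, expectation_conj]
    refine (abs_add_le _ _).trans ?_
    push_cast
    nlinarith [mul_le_mul_of_nonneg_left h3 h0]

end Evolution

/-! ### The hard instances and the test -/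

section HardInstance

variable {K d : ℕ}

/-- The spectrum `(1/2 + y, 1/2 - y, 0, …, 0)`. -/
noncomputable def biasedSpectrum (d : ℕ) (y : ℝ) (k : Fin (d + 2)) : ℝ :=
  if k = 0 then 1 / 2 + y else if k = 1 then 1 / 2 - y else 0

/-- The tuple of diagonal states with spectra `(1/2 ± x, 1/2 ∓ x, 0, …, 0)`, where the signs are
those of the coefficients `c`. -/
noncomputable def biasedTuple (c : Fin K → ℝ) (d : ℕ) (x : ℝ) (j : Fin K) :
    Matrix (Fin (d + 2)) (Fin (d + 2)) ℂ :=
  Matrix.diagonal fun k => (biasedSpectrum d (if 0 ≤ c j then x else -x) k : ℂ)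

lemma isState_biasedTuple (c : Fin K → ℝ) (d : ℕ) {x : ℝ} (hx : |x| ≤ 1 / 2) (j : Fin K) :
    IsState (biasedTuple c d x j) := by
  obtain ⟨h1, h2⟩ := abs_le.1 hx
  refine ⟨Matrix.posSemidef_diagonal_iff.2 fun k => ?_, ?_⟩
  · rw [Complex.zero_le_real, biasedSpectrum]
    split_ifs <;> linarith
  · rw [biasedTuple, Matrix.trace_diagonal, Fin.sum_univ_succ, Fin.sum_univ_succ]
    simp [biasedSpectrum, Fin.ext_iff]
    ring

/-- The spectrum is affine in the bias, so the extreme biases ±1/2 serve as the two outcomes of a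
bit. -/
lemma biasedTuple_eq_mixture (c : Fin K → ℝ) (d : ℕ) (x : ℝ) (j : Fin K) :
    biasedTuple c d x j = ((1 / 2 + x : ℝ) : ℂ) • biasedTuple c d (1 / 2) j +
      ((1 / 2 + -x : ℝ) : ℂ) • biasedTuple c d (-(1 / 2)) j := by
  simp only [biasedTuple, ← Matrix.diagonal_smul, Matrix.diagonal_add]
  congr 1
  ext k
  simp only [Pi.smul_apply, smul_eq_mul, ← Complex.ofReal_mul, ← Complex.ofReal_add]
  congr 1
  simp only [biasedSpectrum]
  split_ifs <;> ring

lemma hamiltonian_biasedTuple (c : Fin K → ℝ) (d : ℕ) (x : ℝ) :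
    hamiltonian c (biasedTuple c d x) = Matrix.diagonal fun k =>
      ((∑ j, c j * biasedSpectrum d (if 0 ≤ c j then x else -x) k : ℝ) : ℂ) := by
  ext k l
  rw [hamiltonian, Matrix.sum_apply]
  by_cases hkl : k = l
  · subst hkl; simp [biasedTuple]
  · simp [biasedTuple, hkl]

lemma gap_biasedTuple (c : Fin K → ℝ) (d : ℕ) (x : ℝ) :
    ∑ j, c j * biasedSpectrum d (if 0 ≤ c j then x else -x) 1 -
      ∑ j, c j * biasedSpectrum d (if 0 ≤ c j then x else -x) 0 = -(2 * x * ∑ j, |c j|) := by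
  rw [← Finset.sum_sub_distrib, Finset.mul_sum, ← Finset.sum_neg_distrib]
  refine Finset.sum_congr rfl fun j _ => ?_
  simp only [biasedSpectrum, if_true, one_ne_zero, if_false]
  split_ifs with h
  · rw [abs_of_nonneg h]; ring
  · rw [abs_of_neg (not_le.1 h)]; ring

lemma sum_eq_add_of_tail_eq_zero (f : Fin (d + 2) → ℂ) (hf : ∀ k : Fin d, f k.succ.succ = 0) :
    ∑ k, f k = f 0 + f 1 := by
  rw [Fin.sum_univ_succ, Fin.sum_univ_succ]
  simp [hf]

/-- The density matrix of the uniform superposition of the first two basis vectors. -/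
noncomputable def plusState (d : ℕ) : Matrix (Fin (d + 2)) (Fin (d + 2)) ℂ :=
  (1 / 2 : ℂ) • Matrix.vecMulVec (fun k => if k = 0 ∨ k = 1 then 1 else 0)
    (star fun k => if k = 0 ∨ k = 1 then 1 else 0)

lemma isState_plusState (d : ℕ) : IsState (plusState d) := by
  refine ⟨(Matrix.posSemidef_vecMulVec_self_star _).smul ?_, ?_⟩
  · rw [one_div, inv_nonneg]; exact zero_le_two
  · have h : ∀ k : Fin d, ¬(k.succ.succ = 0 ∨ k.succ.succ = 1) := fun k => by
      simp only [Fin.ext_iff, Fin.val_succ, Fin.val_zero, Fin.val_one]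
      omega
    rw [plusState, Matrix.trace_smul, Matrix.trace_vecMulVec, dotProduct,
      sum_eq_add_of_tail_eq_zero _ fun k => by rw [if_neg (h k), zero_mul]]
    simp
    norm_num

/-- The vector `(1, i, 0, …, 0)`. -/
noncomputable def phaseVector (d : ℕ) (k : Fin (d + 2)) : ℂ :=
  if k = 0 then 1 else if k = 1 then Complex.I else 0

lemma expectation_phaseVector (X : Matrix (Fin (d + 2)) (Fin (d + 2)) ℂ) :
    expectation (phaseVector d) X = (X 0 0).re + (X 1 1).re - (X 0 1).im + (X 1 0).im := by
  have h0 : ∀ k : Fin d, phaseVector d k.succ.succ = 0 := fun k => by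
    simp [phaseVector, Fin.ext_iff]
  simp only [expectation, dotProduct, Matrix.mulVec]
  iterate 3 rw [sum_eq_add_of_tail_eq_zero _ fun k => by simp [h0]]
  simp [phaseVector]
  ring

lemma expectation_phaseVector_one : expectation (phaseVector d) 1 = 2 := by
  rw [expectation_phaseVector]
  simp
  norm_num

/-- The evolution only rotates the off-diagonal entries, by the accumulated gap phase, and the
vector (1, i) reads off its sine. -/
lemma expectation_evolve_plusState (c : Fin K → ℝ) (d : ℕ) (x t : ℝ) (m : ℕ) :
    expectation (phaseVector d)
      ((evolve (hamiltonian c (biasedTuple c d x)) t)^[m] (plusState d)) =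
      1 + Real.sin (m * t * (2 * x * ∑ j, |c j|)) := by
  have hp : ∀ k l : Fin (d + 2), (k = 0 ∨ k = 1) → (l = 0 ∨ l = 1) →
      plusState d k l = ((1 / 2 : ℝ) : ℂ) := fun k l hk hl => by
    simp [plusState, Matrix.vecMulVec_apply, hk, hl]
  rw [expectation_phaseVector, hamiltonian_biasedTuple]
  simp only [evolve_diagonal_iterate_apply]
  rw [gap_biasedTuple, ← neg_sub (∑ j, c j * biasedSpectrum d (if 0 ≤ c j then x else -x) 1)
      (∑ j, c j * biasedSpectrum d (if 0 ≤ c j then x else -x) 0), gap_biasedTuple,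
    hp 0 0 (by simp) (by simp), hp 0 1 (by simp) (by simp), hp 1 0 (by simp) (by simp),
    hp 1 1 (by simp) (by simp)]
  simp only [Complex.re_mul_ofReal, Complex.im_mul_ofReal, Complex.exp_ofReal_mul_I_re,
    Complex.exp_ofReal_mul_I_im, sub_self, mul_zero, Real.cos_zero, neg_neg, mul_neg, Real.sin_neg]
  ring

end HardInstance

/-! ### Assembling the bound -/

/-- Repeating a simulation until it distinguishes the hard instances bounds its sample count. -/
lemma one_le_of_simulates {K d n m : ℕ} {c : Fin K → ℝ} {t δ x : ℝ}
    {P : Protocol (d + 2) K n} (hx : |x| ≤ 1 / 2)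
    (h1 : Simulates P c (biasedTuple c d x) t δ)
    (h2 : Simulates P c (biasedTuple c d (-x)) t δ)
    (hphase : m * t * (2 * x * ∑ j, |c j|) = Real.pi / 2) (hm : m * δ ≤ 1 / 8) :
    1 ≤ 96 * (m * n : ℕ) * x ^ 2 := by
  have hx' : |-x| ≤ 1 / 2 := by rwa [abs_neg]
  have hmix := IsBitMixture.iterate_output P (isState_plusState d) (ρ := biasedTuple c d)
    (τ := fun b => biasedTuple c d (if b then 1 / 2 else -(1 / 2)))
    (fun b j => isState_biasedTuple c d (by cases b <;> norm_num [abs_of_pos]) j)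
    (fun y j => by simpa using biasedTuple_eq_mixture c d y j) m
  have hsq := hmix.abs_expectation_sub_sq_le (phaseVector d) x
  have e1 := h1.abs_expectation_iterate_sub_le (isState_biasedTuple c d hx)
    (hamiltonian_biasedTuple c d x) (isState_plusState d) m (phaseVector d)
  have e2 := h2.abs_expectation_iterate_sub_le (isState_biasedTuple c d hx')
    (hamiltonian_biasedTuple c d (-x)) (isState_plusState d) m (phaseVector d)
  rw [expectation_sub, expectation_evolve_plusState, expectation_phaseVector_one] at e1 e2
  rw [hphase, Real.sin_pi_div_two] at e1
  rw [show (m : ℝ) * t * (2 * -x * ∑ j, |c j|) = -(m * t * (2 * x * ∑ j, |c j|)) by ring, hphase,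
    Real.sin_neg, Real.sin_pi_div_two] at e2
  rw [expectation_phaseVector_one] at hsq
  -- The ideal values 2 and 0 are each missed by at most 4mδ ≤ 1/2, so the actual values differ by
  -- at least 1.
  refine one_le_mul_sq_of_advantage ?_ hx
  have := (abs_le.1 e1).1
  have := (abs_le.1 e2).2
  nlinarith

end SampleSim

theorem mainTheorem8 :
    ∃ C δ₀ κ₀ : ℝ, 0 < C ∧ 0 < δ₀ ∧ 0 < κ₀ ∧
      ∀ (K : ℕ) (c : Fin K → ℝ) (d : ℕ) (t δ : ℝ), 2 ≤ d →
        0 < δ → δ ≤ δ₀ → δ / ((∑ j, |c j|) * |t|) ≤ κ₀ →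
        ∃ ρ : Fin 2 → Fin K → Matrix (Fin d) (Fin d) ℂ,
          (∀ b j, SampleSim.IsState (ρ b j)) ∧
          ∀ (n : ℕ) (P : SampleSim.Protocol d K n),
            (∀ b, SampleSim.Simulates P c (ρ b) t δ) →
            C * ((∑ j, |c j|) ^ 2 * t ^ 2 / δ) ≤ (n : ℝ) := by
  -- Here 1536 = 96 · 16, the bound 1/8 ensures m ≥ 1, and 1/32 ensures |x| ≤ 1/2.
  refine ⟨1 / 1536, 1 / 8, 1 / 32, by norm_num, by norm_num, by norm_num, ?_⟩
  intro K c d t δ hd hδ hδ₀ hκ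
  obtain ⟨d, rfl⟩ := Nat.exists_eq_add_of_le' hd
  set S := ∑ j, |c j| with hS
  -- In this case the quotient bounded by κ₀ is 0 by convention, and the claim is 0 ≤ n.
  by_cases hSt : S * t = 0
  · refine ⟨fun _ => SampleSim.biasedTuple c d 0,
      fun _ => SampleSim.isState_biasedTuple c d (by norm_num), fun n P _ => ?_⟩
    rw [← mul_pow, hSt]
    simp
  have hS0 : 0 < S :=
    lt_of_le_of_ne (Finset.sum_nonneg fun _ _ => abs_nonneg _) fun h => hSt (by simp [← h])
  have ht0 : t ≠ 0 := fun h => hSt (by simp [h])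
  -- The largest m with mδ ≤ 1/8; as 1/(8δ) ≥ 1, rounding down loses at most a factor 2.
  set m : ℕ := ⌊1 / (8 * δ)⌋₊ with hm
  have hy : 1 ≤ 1 / (8 * δ) := by rw [le_div_iff₀ (by positivity)]; linarith
  have hm1 : (1 : ℝ) ≤ m := by exact_mod_cast (Nat.one_le_floor_iff _).2 hy
  have hm_le : m * δ ≤ 1 / 8 := by
    have := Nat.floor_le (zero_le_one.trans hy)
    rw [← hm, le_div_iff₀ (by positivity)] at this
    linarith
  have hm_ge : 1 ≤ 16 * (m * δ) := by
    have := Nat.lt_floor_add_one (1 / (8 * δ))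
    rw [← hm, div_lt_iff₀ (by positivity)] at this
    nlinarith
  set x : ℝ := Real.pi / (4 * S * t * m) with hx
  have hphase : m * t * (2 * x * S) = Real.pi / 2 := by
    rw [hx]; field_simp; ring
  have hx_le : |x| ≤ 1 / 2 := by
    have hpos : 0 < S * |t| := by positivity
    rw [div_le_iff₀ hpos] at hκ
    rw [hx, abs_div, abs_of_pos Real.pi_pos, abs_mul, abs_mul, abs_mul, abs_of_pos hS0,
      abs_of_pos (by norm_num : (0 : ℝ) < 4), abs_of_nonneg (zero_le_one.trans hm1),
      div_le_iff₀ (by positivity)]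
    -- From S|t| ≥ 32δ and 16mδ ≥ 1 follows S|t|m ≥ 2 ≥ π/2.
    have := Real.pi_le_four
    nlinarith
  refine ⟨![SampleSim.biasedTuple c d x, SampleSim.biasedTuple c d (-x)], fun b j => ?_,
    fun n P hP => ?_⟩
  · fin_cases b
    · exact SampleSim.isState_biasedTuple c d hx_le j
    · exact SampleSim.isState_biasedTuple c d (by rwa [abs_neg]) j
  have key := SampleSim.one_le_of_simulates hx_le (hP 0) (hP 1) hphase hm_le
  rw [hx, div_pow, ← mul_div_assoc, le_div_iff₀ (by positivity)] at key
  push_cast at key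
  have hpi : Real.pi ^ 2 ≤ 16 := by nlinarith [Real.pi_le_four, Real.pi_pos]
  have h1 : S ^ 2 * t ^ 2 * m ≤ 96 * n := by
    have hm0 : (0 : ℝ) < m := by linarith
    refine le_of_mul_le_mul_right ?_ hm0
    have : 96 * (m * n : ℝ) * Real.pi ^ 2 ≤ 96 * (m * n) * 16 := by gcongr
    nlinarith
  rw [← mul_div_assoc, div_le_iff₀ hδ]
  have h2 : S ^ 2 * t ^ 2 * 1 ≤ S ^ 2 * t ^ 2 * (16 * (m * δ)) := by gcongr
  nlinarith [mul_le_mul_of_nonneg_right h1 hδ.le]
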